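/- Let $n\ge 5$, $N=\{1,\dots,n\}$, $A=\{ij : i,j\in N,\ i\ne j\}$, $N_1=N\setminus\{1\}$ and $A_1=\{ij : i,j\in N_1,\ i\neq j\}$. Let $\mathcal C_1$ be the set of (arc sets of) directed cycles, of length at least $2$ and without repeated nodes, all of whose arcs lie in $A_1$, and let $$D=\Big\{d\in\mathbb R^{A_1} : d_{ij}>0\ \text{for all } ij\in A_1,\ \sum_{ij\in C}d_{ij}\le 1\ \text{for all } C\in\mathcal C_1\Big\}.$$ Let $P_{\mathrm{AP}}$ be the set of $x\in[0,1]^A$ such that $\sum_{j\ne i}x_{ij}=1$ and $\sum_{j\neq i}x_{ji}=1$ for all $i\in N$. For $d\in D$, let $P_{\mathrm{DL}}(d)$ be the set of $x\in P_{\mathrm{AP}}$ for which there exists $u\in\mathbb R^{N_1}$ with $$u_i-u_j+x_{ij}+(1-d_{ij}-d_{ji})x_{ji}\le 1-d_{ij}\qquad\text{for all } ij\in A_1 .$$ **Proposition.** Let $d\in D$ and $\delta\in\mathbb R^{A_1}\setminus\{0\}$ be such that $d+\delta\in D$ and $\delta_{ij}=-\delta_{ji}$ for all $ij\in A_1$,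 and assume that there exists $\hat C\in\mathcal C_1$ with $|\hat C|\ge 3$ such that $\sum_{ij\in\hat C}\delta_{ij}\ne 0$. Then $P_{\mathrm{DL}}(d)$ and $P_{\mathrm{DL}}(d+\delta)$ are not comparable, that is, $P_{\mathrm{DL}}(d)\not\subseteq P_{\mathrm{DL}}(d+\delta)$ and $P_{\mathrm{DL}}(d+\delta)\not\subseteq P_{\mathrm{DL}}(d)$. -/

import Mathlib

namespace ATSP

/-- The node set `N = {1, …, n}`; the node called `i` in the text is `i - 1 : Fin n`, so that the
special node `1` is the element with value `0`. -/
abbrev Node (n : ℕ) : Type := Fin n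

/-- The set `N₁ = N \ {1}` of all nodes except the special one. -/
abbrev Node₁ (n : ℕ) : Type := {i : Node n // i.val ≠ 0}

/-- The arcs `ij`, `i ≠ j`, of the complete directed graph on `V`, written as `(i, j)`. -/
abbrev Arc (V : Type) : Type := {a : V × V // a.1 ≠ a.2}

/-- The arc `ji` for an arc `ij`. -/
def Arc.rev {V : Type} (a : Arc V) : Arc V := ⟨(a.1.2, a.1.1), a.2.symm⟩

/-- The inclusion of `A₁` (the arcs that avoid the special node) in the set `A` of all arcs. -/
def Arc.incl {n : ℕ} (a : Arc (Node₁ n)) : Arc (Node n) :=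
  ⟨(a.1.1.1, a.1.2.1), fun h => a.2 (Subtype.ext h)⟩

/-- `C` is the arc set of a directed cycle: for some `k ≥ 2` and distinct nodes
`v₀, …, v₍ₖ₋₁₎`, its arcs are exactly `v₀v₁, v₁v₂, …, v₍ₖ₋₁₎v₀`. (`finRotate k` is the cyclic shift
`t ↦ t + 1` of `Fin k`.) -/
def IsDirectedCycle {V : Type} (C : Finset (Arc V)) : Prop :=
  ∃ k : ℕ, 2 ≤ k ∧ ∃ v : Fin k → V, Function.Injective v ∧
    ∀ a : Arc V, a ∈ C ↔ ∃ t : Fin k, a.1 = (v t, v (finRotate k t))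

/-- The set `𝒞₁` of directed cycles with arcs in `A₁`. -/
def cycles₁ (n : ℕ) : Set (Finset (Arc (Node₁ n))) := {C | IsDirectedCycle C}

/-- The parameter set `D`: strictly positive vectors indexed by `A₁` whose sum over every cycle in
`𝒞₁` is at most `1`. -/
def paramD (n : ℕ) : Set (Arc (Node₁ n) → ℝ) :=
  {d | (∀ a, 0 < d a) ∧ ∀ C ∈ cycles₁ n, ∑ a ∈ C, d a ≤ 1}

/-- The polytope `P_AP` of the (restricted) assignment problem. -/
def assignmentPolytope (n : ℕ) : Set (Arc (Node n) → ℝ) :=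
  {x | (∀ a, 0 ≤ x a ∧ x a ≤ 1) ∧
    (∀ i : Node n, ∑ a : Arc (Node n) with a.1.1 = i, x a = 1) ∧
    (∀ i : Node n, ∑ a : Arc (Node n) with a.1.2 = i, x a = 1)}

/-- The polyhedron `Q_DL(d)` of the extended `d`-DL formulation, in the variables `(x, u)`:
`u_i - u_j + x_ij + (1 - d_ij - d_ji) x_ji ≤ 1 - d_ij` for all `ij ∈ A₁`. -/
def polyQDL (n : ℕ) (d : Arc (Node₁ n) → ℝ) : Set ((Arc (Node n) → ℝ) × (Node₁ n → ℝ)) :=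
  {p | p.1 ∈ assignmentPolytope n ∧ ∀ a : Arc (Node₁ n),
    p.2 a.1.1 - p.2 a.1.2 + p.1 a.incl + (1 - d a - d a.rev) * p.1 a.rev.incl ≤ 1 - d a}

/-- `P_DL(d)`: the projection of `Q_DL(d)` onto the `x`-variables. -/
def polyPDL (n : ℕ) (d : Arc (Node₁ n) → ℝ) : Set (Arc (Node n) → ℝ) :=
  Prod.fst '' polyQDL n d

end ATSP

/-!
Suppose that the antisymmetric vector `δ` has total weight zero on every cycle that misses exactly
one node. Exchanging the node `c` of such a cycle `… → a → c → b → …` for the missed node `w` shows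
that the path `a → c → b` has the same `δ`-weight as `a → w → b`. Hence all triangles have weight
zero, `δ` is a potential difference, and it vanishes on every cycle. So some cycle `σ` missing
exactly one node `w` has nonzero `δ`-weight.

For such a `σ`, reroute one arc `k → σ k` as `k → w → 0 → σ k` and take the convex combination of
the resulting tours with weights `d_{kσ(k)}`, the remaining weight being on `σ` together with the
2-cycle on `w` and the special node `0`. With a suitable label on `w` and zero labels elsewhere
this point lies in `P_DL(d)`. Since `x_{kσ(k)} = 1 - d_{kσ(k)}` and `x_{σ(k)k} = 0`, summing the
inequalities of `P_DL(d')` along `σ` shows that `P_DL(d) ⊆ P_DL(d')` forces `d'(σ) ≤ d(σ)`. Applied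
to `σ` and to the reversed cycle, this makes the `δ`-weight of `σ` zero when `d' = d + δ`.
-/

namespace ATSP

open Equiv Finset

section Arcs

variable {V : Type}

theorem IsDirectedCycle.sum_sub_eq_zero {C : Finset (Arc V)} (hC : IsDirectedCycle C) (p : V → ℝ) :
    ∑ a ∈ C, (p a.1.1 - p a.1.2) = 0 := by
  obtain ⟨k, hk, v, hv, hCv⟩ := hC
  have hne (t : Fin k) : v t ≠ v (finRotate k t) := fun h => by
    have ht : t ∈ (finRotate k).support := support_finRotate_of_le hk ▸ mem_univ t
    exact Perm.mem_support.1 ht (hv h).symm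
  have hsum : ∑ t, (p (v t) - p (v (finRotate k t))) = ∑ a ∈ C, (p a.1.1 - p a.1.2) := by
    refine sum_bij (fun t _ => (⟨(v t, v (finRotate k t)), hne t⟩ : Arc V))
      (fun t _ => (hCv _).2 ⟨t, rfl⟩) (fun t _ t' _ h => hv (congrArg (·.1.1) h))
      (fun a ha => ?_) (fun _ _ => rfl)
    obtain ⟨t, ht⟩ := (hCv a).1 ha
    exact ⟨t, mem_univ t, Subtype.ext ht.symm⟩
  rw [← hsum, sum_sub_distrib, Equiv.sum_comp (finRotate k) fun t => p (v t), sub_self]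

variable [DecidableEq V]

/-- The square matrix of an arc vector, with zeros on the diagonal, where there is no arc. -/
def arcMatrix (f : Arc V → ℝ) (i j : V) : ℝ :=
  if h : i ≠ j then f ⟨(i, j), h⟩ else 0

@[simp]
theorem arcMatrix_self (f : Arc V → ℝ) (i : V) : arcMatrix f i i = 0 := by
  simp [arcMatrix]

theorem arcMatrix_of_ne (f : Arc V → ℝ) {i j : V} (h : i ≠ j) :
    arcMatrix f i j = f ⟨(i, j), h⟩ :=
  dif_pos h

theorem arcMatrix_arc (f : Arc V → ℝ) (a : Arc V) : arcMatrix f a.1.1 a.1.2 = f a :=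
  arcMatrix_of_ne f a.2

theorem arcMatrix_add (f g : Arc V → ℝ) (i j : V) :
    arcMatrix (f + g) i j = arcMatrix f i j + arcMatrix g i j := by
  unfold arcMatrix
  split_ifs <;> simp

theorem arcMatrix_swap {f : Arc V → ℝ} (hf : ∀ a, f a = -f a.rev) (i j : V) :
    arcMatrix f i j = -arcMatrix f j i := by
  by_cases h : i = j
  · simp [h]
  · rw [arcMatrix_of_ne f h, arcMatrix_of_ne f (Ne.symm h), hf]
    rfl

theorem sum_arc_eq_sum_sum [Fintype V] (F : V → V → ℝ) (hF : ∀ i, F i i = 0) :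
    ∑ a : Arc V, F a.1.1 a.1.2 = ∑ i, ∑ j, F i j := by
  rw [← Fintype.sum_prod_type', ← sum_subtype {p : V × V | p.1 ≠ p.2} (by simp) fun p => F p.1 p.2]
  refine sum_filter_of_ne fun p _ hp h => hp ?_
  rw [h, hF]

end Arcs

section Permutations

variable {V : Type} [Fintype V]

/-- The weight `∑ i, g i (σ i)` of a permutation. When `g` vanishes on the diagonal, this is the
total weight of the cycles of `σ`. -/
def permWeight (g : V → V → ℝ) (σ : Perm V) : ℝ :=
  ∑ i, g i (σ i)

theorem permWeight_inv {g : V → V → ℝ} (hg : ∀ i j, g i j = -g j i) (σ : Perm V) :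
    permWeight g σ⁻¹ = -permWeight g σ := by
  simp only [permWeight, ← sum_neg_distrib]
  rw [← Equiv.sum_comp σ]
  exact sum_congr rfl fun i _ => by rw [← Perm.mul_apply, inv_mul_cancel, Perm.one_apply, hg]

theorem permWeight_conj (g : V → V → ℝ) (σ s : Perm V) :
    permWeight g (s * σ * s⁻¹) = ∑ i, g (s i) (s (σ i)) := by
  rw [permWeight, ← Equiv.sum_comp s]
  simp

variable [DecidableEq V]

theorem permWeight_arcMatrix_add (f g : Arc V → ℝ) (σ : Perm V) :
    permWeight (arcMatrix (f + g)) σ =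
      permWeight (arcMatrix f) σ + permWeight (arcMatrix g) σ := by
  simp only [permWeight, arcMatrix_add, sum_add_distrib]

/-- The arcs `ij` with `σ i = j`. -/
def permArcs (σ : Perm V) : Finset (Arc V) :=
  {a | σ a.1.1 = a.1.2}

theorem sum_permArcs (f : Arc V → ℝ) (σ : Perm V) :
    ∑ a ∈ permArcs σ, f a = permWeight (arcMatrix f) σ := by
  calc ∑ a ∈ permArcs σ, f a
      = ∑ a : Arc V, if σ a.1.1 = a.1.2 then arcMatrix f a.1.1 a.1.2 else 0 := by
        simp only [permArcs, sum_filter, arcMatrix_arc]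
    _ = ∑ i, ∑ j, if σ i = j then arcMatrix f i j else 0 :=
        sum_arc_eq_sum_sum (fun i j => if σ i = j then arcMatrix f i j else 0) (by simp)
    _ = permWeight (arcMatrix f) σ := by simp [permWeight]

theorem isDirectedCycle_permArcs {σ : Perm V} (hσ : σ.IsCycle) :
    IsDirectedCycle (permArcs σ) := by
  have hon : σ.IsCycleOn (σ.support : Set V) := by
    rw [Perm.coe_support_eq_set_support]
    exact hσ.isCycleOn
  obtain ⟨x, hx⟩ := hσ.nonempty_support
  have hpow_rotate (t : Fin #σ.support) :
      (σ ^ (finRotate #σ.support t : ℕ)) x = σ ((σ ^ (t : ℕ)) x) := by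
    rw [← Perm.mul_apply, ← pow_succ', hon.pow_apply_eq_pow_apply hx]
    have := t.neZero
    simp [finRotate_apply, Fin.val_add, Nat.ModEq]
  refine ⟨#σ.support, hσ.two_le_card_support, fun t => (σ ^ (t : ℕ)) x, fun s t hst => ?_,
    fun a => ⟨fun ha => ?_, ?_⟩⟩
  · exact Fin.ext (((hon.pow_apply_eq_pow_apply hx).1 hst).eq_of_lt_of_lt s.2 t.2)
  · have ha' : σ a.1.1 = a.1.2 := by simpa [permArcs] using ha
    have hmem : a.1.1 ∈ σ.support := Perm.mem_support.2 (ha' ▸ a.2.symm)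
    obtain ⟨t, ht, htx⟩ := hon.exists_pow_eq hx hmem
    refine ⟨⟨t, ht⟩, Prod.ext htx.symm ?_⟩
    simp only [hpow_rotate, htx, ha']
  · rintro ⟨t, ht⟩
    simp only [permArcs, mem_filter_univ, ht, hpow_rotate]

end Permutations

section CycleMissing

/-- The permutation `σ` is a single cycle through all elements except `w`, which it fixes. -/
structure IsCycleMissing {V : Type} (σ : Perm V) (w : V) : Prop where
  isCycle : σ.IsCycle
  apply_eq_self_iff : ∀ i, σ i = i ↔ i = w

variable {V : Type} {σ : Perm V} {w : V}

namespace IsCycleMissing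

theorem apply_missing (hσ : IsCycleMissing σ w) : σ w = w :=
  (hσ.apply_eq_self_iff w).2 rfl

theorem apply_ne_self (hσ : IsCycleMissing σ w) {i : V} (hi : i ≠ w) : σ i ≠ i :=
  mt (hσ.apply_eq_self_iff i).1 hi

theorem apply_ne_missing (hσ : IsCycleMissing σ w) {i : V} (hi : i ≠ w) : σ i ≠ w :=
  fun h => hi (σ.injective (h.trans hσ.apply_missing.symm))

theorem inv (hσ : IsCycleMissing σ w) : IsCycleMissing σ⁻¹ w :=
  ⟨hσ.isCycle.inv, fun i => by
    rw [Perm.inv_eq_iff_eq, eq_comm, hσ.apply_eq_self_iff]⟩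

theorem conj (hσ : IsCycleMissing σ w) (s : Perm V) : IsCycleMissing (s * σ * s⁻¹) (s w) :=
  ⟨hσ.isCycle.conj, fun i => by
    simp only [Perm.mul_apply]
    rw [← Perm.eq_inv_iff_eq, hσ.apply_eq_self_iff, Perm.inv_eq_iff_eq]⟩

theorem apply_apply_ne_self [Fintype V] (hV : 4 ≤ Fintype.card V) (hσ : IsCycleMissing σ w)
    {i : V} (hi : i ≠ w) : σ (σ i) ≠ i := by
  classical
  intro h
  have hsupp : σ.support = {w}ᶜ := by
    ext j
    simp [hσ.apply_eq_self_iff]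
  have hpow : σ ^ 2 = 1 := (hσ.isCycle.pow_eq_one_iff' (hσ.apply_ne_self hi)).2 h
  have hle := Nat.le_of_dvd two_pos (orderOf_dvd_of_pow_eq_one hpow)
  rw [hσ.isCycle.orderOf, hsupp, card_compl, card_singleton] at hle
  omega

end IsCycleMissing

theorem exists_isCycleMissing_through [Finite V] {a b c : V} (hac : a ≠ c) (hab : a ≠ b)
    (hcb : c ≠ b) (haw : a ≠ w) (hbw : b ≠ w) (hcw : c ≠ w) :
    ∃ σ : Perm V, IsCycleMissing σ w ∧ σ a = c ∧ σ c = b := by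
  classical
  have := Fintype.ofFinite V
  let rest : List V := ({a, c, b, w}ᶜ : Finset V).toList
  have hmem (i : V) : i ∈ a :: c :: b :: rest ↔ i ≠ w := by
    simp only [List.mem_cons, rest, mem_toList, mem_compl, mem_insert, mem_singleton]
    grind
  have hnodup : (a :: c :: b :: rest).Nodup := by
    simp [rest, nodup_toList, hac, hab, hcb]
  refine ⟨(a :: c :: b :: rest).formPerm, ⟨List.isCycle_formPerm hnodup (by simp), fun i => ?_⟩,
    List.formPerm_apply_head _ _ _ hnodup, List.formPerm_apply_lt_getElem _ hnodup 1 (by simp)⟩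
  rw [← not_iff_not, ← ne_eq i w, ← hmem i]
  refine ⟨List.mem_of_formPerm_apply_ne, fun hi => ?_⟩
  exact (List.formPerm_apply_mem_ne_self_iff _ hnodup i hi).2 (by simp)

end CycleMissing

section Potential

variable {V : Type} [Fintype V] {g : V → V → ℝ}

theorem permWeight_conj_swap_sub [DecidableEq V] (hg : ∀ i, g i i = 0) {σ : Perm V} {a c w : V}
    (hw : σ w = w) (hac : a ≠ c) (ha : σ a = c) :
    permWeight g (swap c w * σ * (swap c w)⁻¹) - permWeight g σ =
      (g a w + g w (σ c)) - (g a c + g c (σ c)) := by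
  have hcw : c ≠ w := fun h => hac (σ.injective (by rw [ha, h, hw]))
  have haw : a ≠ w := fun h => hcw (by rw [← ha, h, hw])
  have hσc : σ c ≠ c := fun h => hac (σ.injective (ha.trans h.symm))
  have hσcw : σ c ≠ w := fun h => hcw (σ.injective (h.trans hw.symm))
  have hsame (i : V) (hi : i ∉ ({a, c} : Finset V)) :
      g (swap c w i) (swap c w (σ i)) - g i (σ i) = 0 := by
    obtain ⟨hia, hic⟩ : i ≠ a ∧ i ≠ c := by simpa using hi
    by_cases hiw : i = w
    · simp [hiw, hw, hg]
    · have hσic : σ i ≠ c := fun h => hia (σ.injective (h.trans ha.symm))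
      have hσiw : σ i ≠ w := fun h => hiw (σ.injective (h.trans hw.symm))
      rw [swap_apply_of_ne_of_ne hic hiw, swap_apply_of_ne_of_ne hσic hσiw, sub_self]
  rw [permWeight_conj, permWeight, ← sum_sub_distrib,
    ← sum_subset (subset_univ {a, c}) fun i _ => hsame i, sum_pair hac, ha, swap_apply_left,
    swap_apply_of_ne_of_ne hac haw, swap_apply_of_ne_of_ne hσc hσcw]
  ring

theorem two_path_eq (hg : ∀ i, g i i = 0)
    (h0 : ∀ (σ : Perm V) (w : V), IsCycleMissing σ w → permWeight g σ = 0)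
    {a b c w : V} (hac : a ≠ c) (hab : a ≠ b) (hcb : c ≠ b) (haw : a ≠ w) (hbw : b ≠ w)
    (hcw : c ≠ w) : g a c + g c b = g a w + g w b := by
  classical
  obtain ⟨σ, hσ, rfl, rfl⟩ := exists_isCycleMissing_through hac hab hcb haw hbw hcw
  have hexchange := permWeight_conj_swap_sub hg hσ.apply_missing hac rfl
  rw [h0 _ _ (hσ.conj _), h0 σ w hσ] at hexchange
  linarith

theorem triangle_eq_zero (hV : 4 ≤ Fintype.card V) (hg : ∀ i j, g i j = -g j i)
    (h0 : ∀ (σ : Perm V) (w : V), IsCycleMissing σ w → permWeight g σ = 0) (a b c : V) :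
    g a b + g b c + g c a = 0 := by
  classical
  have hdiag (i : V) : g i i = 0 := by linarith [hg i i]
  rcases eq_or_ne a b with rfl | hab
  · linarith [hg a c, hdiag a]
  rcases eq_or_ne a c with rfl | hac
  · linarith [hg a b, hdiag a]
  rcases eq_or_ne b c with rfl | hbc
  · linarith [hg a b, hdiag b]
  obtain ⟨w, -, hw⟩ := exists_mem_notMem_of_card_lt_card (s := {a, b, c}) (t := univ)
    (card_le_three.trans_lt hV)
  obtain ⟨hwa, hwb, hwc⟩ : w ≠ a ∧ w ≠ b ∧ w ≠ c := by simpa using hw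
  have hbac := two_path_eq hdiag h0 hab.symm hbc hac hwb.symm hwc.symm hwa.symm
  have hcba := two_path_eq hdiag h0 hbc.symm hac.symm hab.symm hwc.symm hwa.symm hwb.symm
  have hacb := two_path_eq hdiag h0 hac hab hbc.symm hwa.symm hwb.symm hwc.symm
  linarith [hg a b, hg b c, hg c a, hg a w, hg b w, hg c w]

theorem exists_isCycleMissing_permWeight_ne_zero [DecidableEq V] (hV : 4 ≤ Fintype.card V)
    {f : Arc V → ℝ} (hf : ∀ a, f a = -f a.rev) {C : Finset (Arc V)} (hC : IsDirectedCycle C)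
    (hne : ∑ a ∈ C, f a ≠ 0) :
    ∃ (σ : Perm V) (w : V), IsCycleMissing σ w ∧ permWeight (arcMatrix f) σ ≠ 0 := by
  by_contra! h0
  obtain ⟨r⟩ : Nonempty V := Fintype.card_pos_iff.1 (by omega)
  have hpotential (a : Arc V) : f a = arcMatrix f a.1.1 r - arcMatrix f a.1.2 r := by
    have htriangle := triangle_eq_zero hV (arcMatrix_swap hf) h0 a.1.1 a.1.2 r
    linarith [arcMatrix_arc f a, arcMatrix_swap hf r a.1.1]
  refine hne ?_
  rw [sum_congr rfl fun a _ => hpotential a]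
  exact hC.sum_sub_eq_zero fun i => arcMatrix f i r

end Potential

section Parameters

variable {n : ℕ} {d : Arc (Node₁ n) → ℝ}

theorem arcMatrix_nonneg (hd : d ∈ paramD n) (i j : Node₁ n) : 0 ≤ arcMatrix d i j := by
  unfold arcMatrix
  split_ifs
  exacts [(hd.1 _).le, le_rfl]

theorem permWeight_le_one (hd : d ∈ paramD n) {σ : Perm (Node₁ n)} (hσ : σ.IsCycle) :
    permWeight (arcMatrix d) σ ≤ 1 :=
  sum_permArcs d σ ▸ hd.2 _ (isDirectedCycle_permArcs hσ)

theorem arcMatrix_add_apply_le_one (hd : d ∈ paramD n) {σ : Perm (Node₁ n)} (hσ : σ.IsCycle)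
    {i j : Node₁ n} (hij : i ≠ j) : arcMatrix d i (σ i) + arcMatrix d j (σ j) ≤ 1 := by
  rw [← sum_pair hij (f := fun k => arcMatrix d k (σ k))]
  exact (sum_le_univ_sum_of_nonneg fun k => arcMatrix_nonneg hd k (σ k)).trans
    (permWeight_le_one hd hσ)

theorem arcMatrix_add_swap_le_one (hd : d ∈ paramD n) (i j : Node₁ n) :
    arcMatrix d i j + arcMatrix d j i ≤ 1 := by
  rcases eq_or_ne i j with rfl | hij
  · simp
  · simpa using arcMatrix_add_apply_le_one hd (Perm.isCycle_swap hij) hij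

theorem arcMatrix_le_one (hd : d ∈ paramD n) (i j : Node₁ n) : arcMatrix d i j ≤ 1 := by
  linarith [arcMatrix_add_swap_le_one hd i j, arcMatrix_nonneg hd j i]

theorem arcMatrix_path_le_one (hd : d ∈ paramD n) {i j : Node₁ n} (hij : i ≠ j) (w : Node₁ n) :
    arcMatrix d i w + arcMatrix d w j ≤ 1 := by
  rcases eq_or_ne i w with rfl | hiw
  · simpa using arcMatrix_le_one hd i j
  rcases eq_or_ne j w with rfl | hjw
  · simpa using arcMatrix_le_one hd i j
  have hcycle := (Perm.isThreeCycle_swap_mul_swap_same hiw.symm hjw.symm hij).isCycle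
  simpa [swap_apply_of_ne_of_ne hiw hij, swap_apply_of_ne_of_ne hjw hij.symm] using
    arcMatrix_add_apply_le_one hd hcycle hiw

-- If the arcs of `σ` are tight and all other labels vanish, the left side is the lower bound on the
-- label of `w` from the arc `iw`, and the right side is the upper bound from the arc `wj`.
theorem label_lower_le_upper (hd : d ∈ paramD n) {σ : Perm (Node₁ n)} (hσ : σ.IsCycle)
    (w i j : Node₁ n) :
    arcMatrix d i (σ i) + arcMatrix d i w - 1 ≤ 1 - arcMatrix d w j -
      (1 - arcMatrix d w j - arcMatrix d j w) * arcMatrix d j (σ j) := by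
  have hwj := arcMatrix_nonneg hd w j
  have hjw := arcMatrix_nonneg hd j w
  rcases eq_or_ne i j with rfl | hij
  · have hprod := mul_nonneg (sub_nonneg.2 (arcMatrix_le_one hd i (σ i)))
      (by linarith [arcMatrix_le_one hd i w, arcMatrix_le_one hd w i] :
        0 ≤ 2 - arcMatrix d w i - arcMatrix d i w)
    linarith
  · have hprod : (1 - arcMatrix d w j - arcMatrix d j w) * arcMatrix d j (σ j) ≤
        arcMatrix d j (σ j) :=
      mul_le_of_le_one_left (arcMatrix_nonneg hd _ _) (by linarith)
    linarith [arcMatrix_path_le_one hd hij w, arcMatrix_add_apply_le_one hd hσ hij]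

theorem exists_label (hd : d ∈ paramD n) {σ : Perm (Node₁ n)} (hσ : σ.IsCycle) (w : Node₁ n) :
    ∃ U : ℝ, (∀ i, arcMatrix d i (σ i) + arcMatrix d i w - 1 ≤ U) ∧
      ∀ j, U ≤ 1 - arcMatrix d w j -
        (1 - arcMatrix d w j - arcMatrix d j w) * arcMatrix d j (σ j) := by
  have : Nonempty (Node₁ n) := ⟨w⟩
  exact ⟨⨆ i, (arcMatrix d i (σ i) + arcMatrix d i w - 1),
    fun i => le_ciSup (f := fun i => arcMatrix d i (σ i) + arcMatrix d i w - 1)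
      (Set.finite_range _).bddAbove i,
    fun j => ciSup_le fun i => label_lower_le_upper hd hσ w i j⟩

end Parameters

section MatrixForm

variable {n : ℕ}

theorem mem_assignmentPolytope_of_doublyStochastic {M : Matrix (Node n) (Node n) ℝ}
    (hM : M ∈ doublyStochastic ℝ (Node n)) (hdiag : ∀ i, M i i = 0) :
    (fun a : Arc (Node n) => M a.1.1 a.1.2) ∈ assignmentPolytope n := by
  refine ⟨fun a => ⟨nonneg_of_mem_doublyStochastic hM, le_one_of_mem_doublyStochastic hM⟩,
    fun i => ?_, fun j => ?_⟩
  · rw [sum_filter, sum_arc_eq_sum_sum (fun k l => if k = i then M k l else 0) (by simp [hdiag])]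
    simpa [sum_ite_irrel] using sum_row_of_mem_doublyStochastic hM i
  · rw [sum_filter, sum_arc_eq_sum_sum (fun k l => if l = j then M k l else 0) (by simp [hdiag])]
    simpa using sum_col_of_mem_doublyStochastic hM j

theorem matrix_mem_polyPDL_iff {d : Arc (Node₁ n) → ℝ} {M : Matrix (Node n) (Node n) ℝ} :
    (fun a : Arc (Node n) => M a.1.1 a.1.2) ∈ polyPDL n d ↔
      (fun a : Arc (Node n) => M a.1.1 a.1.2) ∈ assignmentPolytope n ∧
        ∃ u : Node₁ n → ℝ, ∀ i j : Node₁ n, i ≠ j →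
          u i - u j + M i j + (1 - arcMatrix d i j - arcMatrix d j i) * M j i ≤
            1 - arcMatrix d i j := by
  have hconstraint (u : Node₁ n → ℝ) (i j : Node₁ n) (hij : i ≠ j) :
      u i - u j + M i j + (1 - arcMatrix d i j - arcMatrix d j i) * M j i ≤ 1 - arcMatrix d i j ↔
      u i - u j + M i j + (1 - d ⟨(i, j), hij⟩ - d ⟨(j, i), hij.symm⟩) * M j i ≤
        1 - d ⟨(i, j), hij⟩ := by
    rw [arcMatrix_of_ne d hij, arcMatrix_of_ne d hij.symm]
  constructor
  · rintro ⟨⟨x, u⟩, ⟨hx, hu⟩, rfl⟩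
    exact ⟨hx, u, fun i j hij => (hconstraint u i j hij).2 (hu ⟨(i, j), hij⟩)⟩
  · rintro ⟨hx, u, hu⟩
    exact ⟨⟨_, u⟩, ⟨hx, fun a => (hconstraint u _ _ a.2).1 (hu _ _ a.2)⟩, rfl⟩

end MatrixForm

section Tour

variable {n : ℕ} [NeZero n] {σ : Perm (Node₁ n)} {w k : Node₁ n}

/-- The successor permutation obtained from `σ`, which fixes `w`, by replacing the arc from `k` to
`σ k` with the path `k → w → 0 → σ k` through the special node `0`. If `σ` is a cycle missing `w`,
this is a Hamiltonian cycle for `k ≠ w`, and `σ` together with the 2-cycle on `w` and `0` for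
`k = w`. -/
def tour (σ : Perm (Node₁ n)) (w k : Node₁ n) : Perm (Node n) :=
  Perm.ofSubtype σ * swap 0 (k : Node n) * swap (k : Node n) w

theorem coe_ne_zero (i : Node₁ n) : (i : Node n) ≠ 0 :=
  fun h => i.2 (by simp [h])

theorem card_node₁ : Fintype.card (Node₁ n) = n - 1 := by
  simp [Node₁]

theorem tour_apply_zero : tour σ w k 0 = σ k := by
  simp [tour, swap_apply_of_ne_of_ne (coe_ne_zero k).symm (coe_ne_zero w).symm,
    Perm.ofSubtype_apply_coe]

theorem tour_apply_missing : tour σ w k w = 0 := by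
  simp [tour, Perm.ofSubtype_apply_of_not_mem]

theorem tour_apply_of_ne (hw : σ w = w) {i : Node₁ n} (hi : i ≠ w) :
    tour σ w k i = if i = k then (w : Node n) else (σ i : Node n) := by
  have hiw : (i : Node n) ≠ w := Subtype.coe_ne_coe.2 hi
  split_ifs with hik
  · have hwi : (w : Node n) ≠ i := hiw.symm
    simp [tour, ← hik, swap_apply_of_ne_of_ne (coe_ne_zero w) hwi, hw, Perm.ofSubtype_apply_coe]
  · have hik' : (i : Node n) ≠ k := Subtype.coe_ne_coe.2 hik
    simp [tour, swap_apply_of_ne_of_ne hik' hiw, swap_apply_of_ne_of_ne (coe_ne_zero i) hik',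
      Perm.ofSubtype_apply_coe]

theorem tour_apply_ne_self (hσ : IsCycleMissing σ w) (i : Node n) : tour σ w k i ≠ i := by
  rcases eq_or_ne i 0 with rfl | hi
  · rw [tour_apply_zero]
    exact coe_ne_zero _
  lift i to Node₁ n using fun h => hi (Fin.ext h)
  rcases eq_or_ne i w with rfl | hiw
  · rw [tour_apply_missing]
    exact (coe_ne_zero i).symm
  rw [tour_apply_of_ne hσ.apply_missing hiw]
  split_ifs
  exacts [Subtype.coe_ne_coe.2 hiw.symm, Subtype.coe_ne_coe.2 (hσ.apply_ne_self hiw)]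

end Tour

section TightPoint

variable {n : ℕ} {d d' : Arc (Node₁ n) → ℝ} {σ : Perm (Node₁ n)} {w : Node₁ n}

/-- The convex weights `d_{kσ(k)}` of the tours `tour σ w k` for `k ≠ w`, the rest of the weight
being on `tour σ w w`. -/
def tourWeight (d : Arc (Node₁ n) → ℝ) (σ : Perm (Node₁ n)) (w k : Node₁ n) : ℝ :=
  arcMatrix d k (σ k) + if k = w then 1 - permWeight (arcMatrix d) σ else 0

theorem tourWeight_of_ne {k : Node₁ n} (hk : k ≠ w) :
    tourWeight d σ w k = arcMatrix d k (σ k) := by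
  simp [tourWeight, hk]

theorem tourWeight_nonneg (hd : d ∈ paramD n) (hσ : σ.IsCycle) (k : Node₁ n) :
    0 ≤ tourWeight d σ w k := by
  refine add_nonneg (arcMatrix_nonneg hd _ _) ?_
  split_ifs
  exacts [sub_nonneg.2 (permWeight_le_one hd hσ), le_rfl]

theorem sum_tourWeight : ∑ k, tourWeight d σ w k = 1 := by
  simp [tourWeight, sum_add_distrib, permWeight]

variable [NeZero n]

/-- A point of `P_DL(d)`, as a doubly stochastic matrix, at which the `d`-DL inequalities of the
arcs of the cycle `σ` missing `w` are tight. -/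
def tightPoint (d : Arc (Node₁ n) → ℝ) (σ : Perm (Node₁ n)) (w : Node₁ n) :
    Matrix (Node n) (Node n) ℝ :=
  ∑ k, tourWeight d σ w k • (tour σ w k).permMatrix ℝ

theorem tightPoint_mem_doublyStochastic (hd : d ∈ paramD n) (hσ : σ.IsCycle) :
    tightPoint d σ w ∈ doublyStochastic ℝ (Node n) :=
  convex_doublyStochastic.sum_mem (fun k _ => tourWeight_nonneg hd hσ k) sum_tourWeight
    fun _ _ => permMatrix_mem_doublyStochastic

theorem tightPoint_apply (i j : Node n) :
    tightPoint d σ w i j = ∑ k, tourWeight d σ w k * if tour σ w k i = j then 1 else 0 := by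
  simp [tightPoint, Matrix.sum_apply, PEquiv.toMatrix_apply]

theorem tightPoint_self (hσ : IsCycleMissing σ w) (i : Node n) : tightPoint d σ w i i = 0 := by
  simp [tightPoint_apply, tour_apply_ne_self hσ]

theorem tightPoint_missing (j : Node₁ n) : tightPoint d σ w w j = 0 := by
  simp [tightPoint_apply, tour_apply_missing, (coe_ne_zero j).symm]

theorem tightPoint_of_ne (hw : σ w = w) {i : Node₁ n} (hi : i ≠ w) (j : Node₁ n) :
    tightPoint d σ w i j =
      (if w = j then arcMatrix d i (σ i) else 0) +
        if σ i = j then 1 - arcMatrix d i (σ i) else 0 := by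
  have hsplit (k : Node₁ n) : tourWeight d σ w k * (if tour σ w k i = j then 1 else 0) =
      (if i = k then tourWeight d σ w k * ((if w = j then 1 else 0) - if σ i = j then 1 else 0)
        else 0) + tourWeight d σ w k * if σ i = j then 1 else 0 := by
    rw [tour_apply_of_ne hw hi]
    by_cases hik : i = k <;> simp [hik, mul_sub, Subtype.coe_inj]
  simp only [tightPoint_apply, hsplit, sum_add_distrib, ← sum_mul, sum_tourWeight, sum_ite_eq,
    mem_univ, if_true, tourWeight_of_ne hi]
  split_ifs <;> ring

theorem tightPoint_apply_missing (hσ : IsCycleMissing σ w) {i : Node₁ n} (hi : i ≠ w) :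
    tightPoint d σ w i w = arcMatrix d i (σ i) := by
  simp [tightPoint_of_ne hσ.apply_missing hi, hσ.apply_ne_missing hi]

theorem tightPoint_apply_perm (hσ : IsCycleMissing σ w) {i : Node₁ n} (hi : i ≠ w) :
    tightPoint d σ w i (σ i) = 1 - arcMatrix d i (σ i) := by
  simp [tightPoint_of_ne hσ.apply_missing hi, (hσ.apply_ne_missing hi).symm]

theorem tightPoint_eq_zero (hw : σ w = w) {i j : Node₁ n} (hi : i ≠ w) (hj : j ≠ w)
    (hij : σ i ≠ j) : tightPoint d σ w i j = 0 := by
  simp [tightPoint_of_ne hw hi, hj.symm, hij]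

theorem tightPoint_constraint (hV : 4 ≤ Fintype.card (Node₁ n)) (hd : d ∈ paramD n)
    (hσ : IsCycleMissing σ w) {i j : Node₁ n} (hi : i ≠ w) (hj : j ≠ w) :
    tightPoint d σ w i j + (1 - arcMatrix d i j - arcMatrix d j i) * tightPoint d σ w j i ≤
      1 - arcMatrix d i j := by
  have hw := hσ.apply_missing
  by_cases hij : σ i = j
  · subst hij
    rw [tightPoint_apply_perm hσ hi,
      tightPoint_eq_zero hw hj hi (hσ.apply_apply_ne_self hV hi), mul_zero, add_zero]
  rw [tightPoint_eq_zero hw hi hj hij]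
  by_cases hji : σ j = i
  · subst hji
    rw [tightPoint_apply_perm hσ hj]
    have hprod : (1 - arcMatrix d (σ j) j - arcMatrix d j (σ j)) * (1 - arcMatrix d j (σ j)) ≤
        1 - arcMatrix d (σ j) j - arcMatrix d j (σ j) :=
      mul_le_of_le_one_right (by linarith [arcMatrix_add_swap_le_one hd (σ j) j])
        (by linarith [arcMatrix_nonneg hd j (σ j)])
    linarith [arcMatrix_nonneg hd j (σ j)]
  · rw [tightPoint_eq_zero hw hj hi hji]
    linarith [arcMatrix_le_one hd i j]

theorem tightPoint_mem_polyPDL (hV : 4 ≤ Fintype.card (Node₁ n)) (hd : d ∈ paramD n)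
    (hσ : IsCycleMissing σ w) :
    (fun a : Arc (Node n) => tightPoint d σ w a.1.1 a.1.2) ∈ polyPDL n d := by
  obtain ⟨U, hlower, hupper⟩ := exists_label hd hσ.isCycle w
  refine matrix_mem_polyPDL_iff.2 ⟨mem_assignmentPolytope_of_doublyStochastic
    (tightPoint_mem_doublyStochastic hd hσ.isCycle) (tightPoint_self hσ),
    Pi.single w U, fun i j hij => ?_⟩
  rcases eq_or_ne i w with rfl | hi
  · rw [Pi.single_eq_same, Pi.single_eq_of_ne hij.symm, tightPoint_missing,
      tightPoint_apply_missing hσ hij.symm]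
    linarith [hupper j]
  rcases eq_or_ne j w with rfl | hj
  · rw [Pi.single_eq_same, Pi.single_eq_of_ne hij, tightPoint_missing,
      tightPoint_apply_missing hσ hij]
    linarith [hlower i]
  · rw [Pi.single_eq_of_ne hi, Pi.single_eq_of_ne hj, sub_zero, zero_add]
    exact tightPoint_constraint hV hd hσ hi hj

theorem permWeight_le_of_polyPDL_subset (hV : 4 ≤ Fintype.card (Node₁ n)) (hd : d ∈ paramD n)
    (hsub : polyPDL n d ⊆ polyPDL n d') (hσ : IsCycleMissing σ w) :
    permWeight (arcMatrix d') σ ≤ permWeight (arcMatrix d) σ := by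
  obtain ⟨-, u, hu⟩ := matrix_mem_polyPDL_iff.1 (hsub (tightPoint_mem_polyPDL hV hd hσ))
  have harc (i : Node₁ n) :
      arcMatrix d' i (σ i) ≤ arcMatrix d i (σ i) + (u (σ i) - u i) := by
    rcases eq_or_ne i w with rfl | hi
    · simp [hσ.apply_missing]
    · have hi' := hu i (σ i) (hσ.apply_ne_self hi).symm
      rw [tightPoint_apply_perm hσ hi, tightPoint_eq_zero hσ.apply_missing
        (hσ.apply_ne_missing hi) hi (hσ.apply_apply_ne_self hV hi)] at hi'
      linarith
  calc permWeight (arcMatrix d') σ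
      ≤ ∑ i, (arcMatrix d i (σ i) + (u (σ i) - u i)) := sum_le_sum fun i _ => harc i
    _ = permWeight (arcMatrix d) σ := by
      rw [sum_add_distrib, sum_sub_distrib, Equiv.sum_comp σ u, sub_self, add_zero, permWeight]

end TightPoint

end ATSP

theorem mainTheorem11 (n : ℕ) (hn : 5 ≤ n)
    (d δ : ATSP.Arc (ATSP.Node₁ n) → ℝ)
    (hd : d ∈ ATSP.paramD n) (hδ : δ ≠ 0) (hdδ : d + δ ∈ ATSP.paramD n)
    (hanti : ∀ a : ATSP.Arc (ATSP.Node₁ n), δ a = -δ a.rev)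
    (hC : ∃ C ∈ ATSP.cycles₁ n, 3 ≤ C.card ∧ ∑ a ∈ C, δ a ≠ 0) :
    ¬ ATSP.polyPDL n d ⊆ ATSP.polyPDL n (d + δ) ∧
      ¬ ATSP.polyPDL n (d + δ) ⊆ ATSP.polyPDL n d := by
  obtain ⟨C, hC, -, hne⟩ := hC
  have : NeZero n := ⟨by omega⟩
  have hV : 4 ≤ Fintype.card (ATSP.Node₁ n) := by
    rw [ATSP.card_node₁]
    omega
  obtain ⟨σ, w, hσ, hweight⟩ :=
    ATSP.exists_isCycleMissing_permWeight_ne_zero hV hanti hC hne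
  have hinv := ATSP.permWeight_inv (ATSP.arcMatrix_swap hanti) σ
  have hadd := ATSP.permWeight_arcMatrix_add d δ
  constructor <;> intro hsub <;> refine hweight ?_
  · have hle := ATSP.permWeight_le_of_polyPDL_subset hV hd hsub hσ
    have hle_inv := ATSP.permWeight_le_of_polyPDL_subset hV hd hsub hσ.inv
    linarith [hadd σ, hadd σ⁻¹]
  · have hle := ATSP.permWeight_le_of_polyPDL_subset hV hdδ hsub hσ
    have hle_inv := ATSP.permWeight_le_of_polyPDL_subset hV hdδ hsub hσ.inv
    linarith [hadd σ, hadd σ⁻¹]
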